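/- Let $m,n$ be natural numbers, $r:=\min\{m,n\}$, let $L\ge 1$ be an integer, $q:=2/L$, $\lambda>0$, and let $M^\natural\in\mathbb{R}^{m\times n}$. For $A\in\mathbb{R}^{m\times n}$ let $\sigma_1(A)\ge\dots\ge\sigma_r(A)\ge 0$ be its singular values and $\|A\|_{\mathcal S^{q}}=\big(\sum_{i=1}^r\sigma_i(A)^{q}\big)^{1/q}$ its Schatten-$q$ (quasi-)norm. A pair $(U,V)$ of orthogonal matrices $U\in\mathbb{R}^{m\times m}$, $V\in\mathbb{R}^{n\times n}$ is called a pair of singular bases of $A$ if $A=U\Sigma_A V^\top$, where $\Sigma_A\in\mathbb{R}^{m\times n}$ is the rectangular diagonal matrix with diagonal entries $\sigma_1(A),\dots,\sigma_r(A)$ in this order. Consider $$\min_{M\in\mathbb{R}^{m\times n}}\ \mathcal L_{M^\natural}(M):=\|M^\natural-M\|_F^2+\lambda\|M\|_{\mathcal S^{2/L}}^{2/L}.$$ If $L\ge 3$, suppose in addition that for every $i\in\{1,\dots,r\}$ $$\sigma_i(M^\natural)\neq\Big(1-\frac q2\Big)\lambda^{\frac1{2-q}}(1-q)^{\frac{q-1}{2-q}};$$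 for $L\in\{1,2\}$ no such condition is imposed. Then $\mathcal L_{M^\natural}$ has exactly one global minimizer $M^*$. Moreover, $M^\natural$ has a pair of singular bases, every pair of singular bases of $M^\natural$ is also a pair of singular bases of $M^*$, and for every $i\in\{1,\dots,r\}$ the number $\sigma_i(M^*)$ is the unique minimizer over $x\ge 0$ of the scalar function $x\mapsto(\sigma_i(M^\natural)-x)^2+\lambda x^{q}$. -/

import Mathlib

open Matrix
open scoped Matrix.Norms.Frobenius

noncomputable section

namespace SchattenReg

/-- The vector of the `min m n` singular values of a real `m × n` matrix, in non-increasing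
order. -/
def sigma {m n : ℕ} (A : Matrix (Fin m) (Fin n) ℝ) (i : Fin (min m n)) : ℝ :=
  (Matrix.toEuclideanLin A).singularValues i

/-- The Schatten-`p` (quasi-)norm. -/
def schattenNorm {m n : ℕ} (p : ℝ) (A : Matrix (Fin m) (Fin n) ℝ) : ℝ :=
  (∑ i, sigma A i ^ p) ^ (1 / p)

/-- The rectangular diagonal matrix with diagonal entries `x i`. -/
def rectDiag {m n : ℕ} (x : Fin (min m n) → ℝ) : Matrix (Fin m) (Fin n) ℝ :=
  Matrix.of fun i j =>
    if h : (i : ℕ) = (j : ℕ) then x ⟨i, lt_min i.isLt (h ▸ j.isLt)⟩ else 0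

/-- `A = U Σ Vᵀ` is a full singular value decomposition: `U` and `V` are orthogonal, and `Σ`
carries the singular values of `A` on its diagonal in non-increasing order. -/
def IsSVD {m n : ℕ} (A : Matrix (Fin m) (Fin n) ℝ) (U : Matrix (Fin m) (Fin m) ℝ)
    (V : Matrix (Fin n) (Fin n) ℝ) : Prop :=
  U ∈ Matrix.orthogonalGroup (Fin m) ℝ ∧ V ∈ Matrix.orthogonalGroup (Fin n) ℝ ∧
    A = U * rectDiag (sigma A) * Vᵀ

/-- The Schatten-`(2/L)` regularized loss with target `T`; the matrix norm is the Frobenius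
norm. -/
def loss {m n : ℕ} (L : ℕ) (lam : ℝ) (T M : Matrix (Fin m) (Fin n) ℝ) : ℝ :=
  ‖T - M‖ ^ 2 + lam * schattenNorm (2 / (L : ℝ)) M ^ (2 / (L : ℝ))

/-- The set of global minimizers of the regularized loss. -/
def minimizers {m n : ℕ} (L : ℕ) (lam : ℝ) (T : Matrix (Fin m) (Fin n) ℝ) :
    Set (Matrix (Fin m) (Fin n) ℝ) :=
  {M | ∀ N, loss L lam T M ≤ loss L lam T N}

/-- The loss of the scalar problem with exponent `q` and target `a`. -/
def scalarLoss (q lam a x : ℝ) : ℝ := (a - x) ^ 2 + lam * x ^ q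

/-- The set of minimizers of the scalar problem over the nonnegative reals. -/
def scalarMinimizers (q lam a : ℝ) : Set ℝ :=
  {x | 0 ≤ x ∧ ∀ y, 0 ≤ y → scalarLoss q lam a x ≤ scalarLoss q lam a y}

/-- The critical value `(1 - q/2) λ^{1/(2-q)} (1-q)^{(q-1)/(2-q)}`. -/
def threshold (q lam : ℝ) : ℝ :=
  (1 - q / 2) * lam ^ (1 / (2 - q)) * (1 - q) ^ ((q - 1) / (2 - q))

end SchattenReg

end

namespace SchattenReg

/-! Let `s` and `p` be the singular values of the target `T = U Σ_s Vᵀ` and of a competitor `N = U'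
Σ_p V'ᵀ`, put `h_i(y) = (s_i - y)² + λ y^q`, let `x_i` be the unique minimizer of `h_i`, and set `W
= Uᵀ U'`, `Z = Vᵀ V'`. Rows and columns of the squared entries of `W` and `Z` sum to one, so
polarizing the cross term `-2 ∑ s_i p_j W_ij Z_ij` gives the exact identity `loss_excess`: loss(N) =
∑ h_i(x_i) + ½ ∑ W_ij² (h_i(p_j) - h_i(x_i)) + ½ ∑ Z_ij² (h_i(p_j) - h_i(x_i)) + ∑ s_i p_j (W_ij -
Z_ij)². Every excess term is nonnegative, which gives the lower bound without a trace inequality. If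
all of them vanish, `conj_seqDiag_eq_of_support` yields `N = U Σ_x Vᵀ`. The bound is attained there:
`x` is non-increasing by `scalarMinimizers_mono`, so `U Σ_x Vᵀ` is a singular value decomposition.
The threshold enters only in the uniqueness of `x_i`, `scalarMinimizers_eq_singleton`. -/

/-! ### The scalar problem. -/

theorem scalarMinimizers_target_zero {q lam : ℝ} (hq : 0 < q) (hlam : 0 < lam) :
    scalarMinimizers q lam 0 = {0} := by
  ext x
  simp only [scalarMinimizers, scalarLoss, Set.mem_ofPred_eq, Set.mem_singleton_iff]
  constructor
  · rintro ⟨hx, h⟩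
    have h0 := h 0 le_rfl
    rw [Real.zero_rpow hq.ne'] at h0
    have := mul_nonneg hlam.le (Real.rpow_nonneg hx q)
    nlinarith
  · rintro rfl
    refine ⟨le_rfl, fun y hy => ?_⟩
    rw [Real.zero_rpow hq.ne']
    have := mul_nonneg hlam.le (Real.rpow_nonneg hy q)
    nlinarith [sq_nonneg y]

theorem scalarMinimizers_two {lam : ℝ} (hlam : 0 < lam) {a : ℝ} (ha : 0 ≤ a) :
    ∃ x, scalarMinimizers 2 lam a = {x} := by
  have h1 : 0 < 1 + lam := by linarith
  have key : ∀ y : ℝ, scalarLoss 2 lam a y =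
      scalarLoss 2 lam a (a / (1 + lam)) + (1 + lam) * (y - a / (1 + lam)) ^ 2 := by
    intro y
    simp only [scalarLoss, Real.rpow_two]
    field_simp
    ring
  refine ⟨a / (1 + lam), ?_⟩
  ext x
  simp only [scalarMinimizers, Set.mem_ofPred_eq, Set.mem_singleton_iff]
  constructor
  · rintro ⟨-, h⟩
    have h2 := h (a / (1 + lam)) (by positivity)
    rw [key x] at h2
    have h3 : (x - a / (1 + lam)) ^ 2 ≤ 0 := by
      by_contra! h4
      have := mul_pos h1 h4
      linarith
    have := pow_eq_zero_iff (two_ne_zero) |>.1 (le_antisymm h3 (sq_nonneg _))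
    linarith
  · rintro rfl
    refine ⟨by positivity, fun y _ => ?_⟩
    rw [key y]
    have := mul_nonneg h1.le (sq_nonneg (y - a / (1 + lam)))
    linarith

theorem scalarMinimizers_one {lam : ℝ} {a : ℝ} :
    ∃ x, scalarMinimizers 1 lam a = {x} := by
  -- Soft thresholding, with the quadratic growth that gives uniqueness.
  have key : ∀ y : ℝ, 0 ≤ y → scalarLoss 1 lam a (max (a - lam / 2) 0) +
      (y - max (a - lam / 2) 0) ^ 2 ≤ scalarLoss 1 lam a y := by
    intro y hy
    simp only [scalarLoss, Real.rpow_one]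
    rcases le_total (a - lam / 2) 0 with h | h
    · rw [max_eq_right h]
      nlinarith [mul_nonneg hy (sub_nonneg.2 h)]
    · rw [max_eq_left h]
      nlinarith
  refine ⟨max (a - lam / 2) 0, ?_⟩
  ext x
  simp only [scalarMinimizers, Set.mem_ofPred_eq, Set.mem_singleton_iff]
  constructor
  · rintro ⟨hx, h⟩
    have h2 := h _ (le_max_right (a - lam / 2) 0)
    have h3 := key x hx
    have := pow_eq_zero_iff (two_ne_zero) |>.1
      (le_antisymm (by linarith) (sq_nonneg (x - max (a - lam / 2) 0)))
    linarith
  · rintro rfl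
    refine ⟨le_max_right _ _, fun y hy => ?_⟩
    linarith [key y hy, sq_nonneg (y - max (a - lam / 2) 0)]

theorem scalarMinimizers_nonempty {q lam a : ℝ} (hq : 0 < q) (hlam : 0 < lam) (ha : 0 ≤ a) :
    (scalarMinimizers q lam a).Nonempty := by
  have hc : ContinuousOn (scalarLoss q lam a) (Set.Icc 0 a) := by
    unfold scalarLoss
    exact ((continuous_const.sub continuous_id).pow 2 |>.add
      (continuous_const.mul (Real.continuous_rpow_const hq.le))).continuousOn
  -- The interval `[0, a]` suffices: beyond `a` both terms of the loss are at least their values at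
  -- `a`.
  obtain ⟨x, hx, hmin⟩ := isCompact_Icc.exists_isMinOn ⟨0, le_rfl, ha⟩ hc
  refine ⟨x, hx.1, fun y hy => ?_⟩
  rcases le_total y a with h | h
  · exact hmin ⟨hy, h⟩
  · refine (hmin ⟨ha, le_rfl⟩ : scalarLoss q lam a x ≤ scalarLoss q lam a a).trans ?_
    simp only [scalarLoss]
    have := mul_le_mul_of_nonneg_left (Real.rpow_le_rpow ha h hq.le) hlam.le
    nlinarith [sq_nonneg (a - y)]

theorem hasDerivAt_scalarLoss {q lam a x : ℝ} (hx : 0 < x) :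
    HasDerivAt (scalarLoss q lam a) (2 * (x - a) + lam * (q * x ^ (q - 1))) x := by
  have h1 := (((hasDerivAt_id x).const_sub a).pow 2).add
    ((Real.hasDerivAt_rpow_const (p := q) (Or.inl hx.ne')).const_mul lam)
  convert! h1 using 1
  simp
  ring

theorem scalarLoss_deriv_eq_zero {q lam a x : ℝ} (hx : 0 < x)
    (hmin : x ∈ scalarMinimizers q lam a) : 2 * (x - a) + lam * (q * x ^ (q - 1)) = 0 := by
  refine IsLocalMin.hasDerivAt_eq_zero ?_ (hasDerivAt_scalarLoss hx)
  filter_upwards [lt_mem_nhds hx] with y hy using hmin.2 y hy.le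

/-- Two positive minimizers have equal values, so the derivative vanishes at both and, by Rolle, at
a point between. Rolle again gives two zeros of the second derivative `2 - λ q (1 - q) t^(q-2)`,
which is strictly increasing. -/
theorem eq_of_pos_mem_scalarMinimizers {q lam a x y : ℝ} (hq : 0 < q) (hq1 : q < 1)
    (hlam : 0 < lam) (hx : 0 < x) (hy : 0 < y) (hxm : x ∈ scalarMinimizers q lam a)
    (hym : y ∈ scalarMinimizers q lam a) : x = y := by
  wlog hxy : x < y generalizing x y
  · rcases lt_trichotomy x y with h | h | h
    · exact absurd h hxy
    · exact h
    · exact (this hy hx hym hxm h).symm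
  exfalso
  have hd1 : ∀ t, 0 < t → HasDerivAt (fun t => 2 * (t - a) + lam * (q * t ^ (q - 1)))
      (2 + lam * (q * ((q - 1) * t ^ (q - 1 - 1)))) t := by
    intro t ht
    have h1 := (((hasDerivAt_id t).sub_const a).const_mul 2).add
      (((Real.hasDerivAt_rpow_const (p := q - 1) (Or.inl ht.ne')).const_mul q).const_mul lam)
    convert! h1 using 1
    simp
  obtain ⟨z, hz, hz0⟩ := exists_hasDerivAt_eq_zero (f := scalarLoss q lam a)
    (f' := fun t => 2 * (t - a) + lam * (q * t ^ (q - 1))) hxy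
    (fun t ht => (hasDerivAt_scalarLoss (hx.trans_le ht.1)).continuousAt.continuousWithinAt)
    (le_antisymm (hxm.2 y hy.le) (hym.2 x hx.le))
    (fun t ht => hasDerivAt_scalarLoss (hx.trans ht.1))
  have hz' : 0 < z := hx.trans hz.1
  obtain ⟨u, hu, hu0⟩ := exists_hasDerivAt_eq_zero hz.1
    (fun t ht => (hd1 t (hx.trans_le ht.1)).continuousAt.continuousWithinAt)
    ((scalarLoss_deriv_eq_zero hx hxm).trans hz0.symm)
    (fun t ht => hd1 t (hx.trans ht.1))
  obtain ⟨v, hv, hv0⟩ := exists_hasDerivAt_eq_zero hz.2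
    (fun t ht => (hd1 t (hz'.trans_le ht.1)).continuousAt.continuousWithinAt)
    (hz0.trans (scalarLoss_deriv_eq_zero hy hym).symm)
    (fun t ht => hd1 t (hz'.trans ht.1))
  have huv : v ^ (q - 1 - 1) < u ^ (q - 1 - 1) :=
    Real.rpow_lt_rpow_of_neg (hx.trans hu.1) (hu.2.trans hv.1) (by linarith)
  have hc : 0 < lam * (q * (1 - q)) := mul_pos hlam (mul_pos hq (by linarith))
  have := mul_lt_mul_of_pos_left huv hc
  linarith

/-- A tie between `0` and `y > 0` gives two equations, stationarity and equality of values. They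
determine `y` and then `a`. -/
theorem eq_threshold_of_zero_mem_scalarMinimizers {q lam a y : ℝ} (hq : 0 < q) (hq1 : q < 1)
    (hlam : 0 < lam) (hy : 0 < y) (h0 : 0 ∈ scalarMinimizers q lam a)
    (hym : y ∈ scalarMinimizers q lam a) : a = threshold q lam := by
  have h1 := scalarLoss_deriv_eq_zero hy hym
  have h2 := le_antisymm (hym.2 0 le_rfl) (h0.2 y hy.le)
  simp only [scalarLoss, Real.zero_rpow hq.ne'] at h2
  have h3 : y ^ q = y ^ (q - 1) * y := by
    rw [← Real.rpow_add_one hy.ne']; ring_nf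
  have h1q : 0 < 1 - q := by linarith
  have h2q : 0 < 2 - q := by linarith
  -- Multiplying stationarity by `y` and subtracting the equality of values eliminates `a`.
  have h4 : y = lam * (1 - q) * y ^ (q - 1) := by
    rw [h3] at h2
    have : y * (y - lam * (1 - q) * y ^ (q - 1)) = 0 := by
      linear_combination y * h1 - h2
    rcases mul_eq_zero.1 this with h | h <;> linarith
  have h5 : y ^ (2 - q) = lam * (1 - q) := by
    have h6 : y ^ (2 - q) * y ^ (q - 1) = y := by
      rw [← Real.rpow_add hy]; ring_nf; simp
    have h7 : 0 < y ^ (q - 1) := Real.rpow_pos_of_pos hy _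
    exact mul_right_cancel₀ h7.ne' (h6.trans h4)
  have h6 : y = lam ^ (1 / (2 - q)) * (1 - q) ^ (1 / (2 - q)) := by
    rw [← Real.mul_rpow hlam.le h1q.le, ← h5, ← Real.rpow_mul hy.le, mul_one_div_cancel h2q.ne',
      Real.rpow_one]
  have h7 : (1 - q) ^ ((q - 1) / (2 - q)) * (1 - q) = (1 - q) ^ (1 / (2 - q)) := by
    rw [← Real.rpow_add_one h1q.ne']
    congr 1
    field_simp
    ring
  have h8 : a * (1 - q) = (1 - q / 2) * y := by
    linear_combination (-(1 - q) / 2) * h1 - q / 2 * h4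
  rw [threshold]
  refine mul_right_cancel₀ h1q.ne' ?_
  rw [mul_assoc, h7, mul_assoc, ← h6, h8]

theorem scalarMinimizers_eq_singleton {L : ℕ} (hL : 1 ≤ L) {lam : ℝ} (hlam : 0 < lam) {a : ℝ}
    (ha : 0 ≤ a) (hth : 3 ≤ L → a ≠ threshold (2 / (L : ℝ)) lam) :
    ∃ x, scalarMinimizers (2 / (L : ℝ)) lam a = {x} := by
  obtain rfl | rfl | h3 : L = 1 ∨ L = 2 ∨ 3 ≤ L := by omega
  · simpa using scalarMinimizers_two hlam ha
  · simpa using scalarMinimizers_one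
  have hLr : (3 : ℝ) ≤ L := by exact_mod_cast h3
  have hq : 0 < 2 / (L : ℝ) := by positivity
  have hq1 : 2 / (L : ℝ) < 1 := by rw [div_lt_one (by linarith)]; linarith
  obtain ⟨x, hx⟩ := scalarMinimizers_nonempty hq hlam ha
  refine ⟨x, Set.eq_singleton_iff_unique_mem.2 ⟨hx, fun y hy => ?_⟩⟩
  rcases hx.1.eq_or_lt with rfl | hx0 <;> rcases hy.1.eq_or_lt with hy0 | hy0
  · exact hy0.symm
  · exact absurd (eq_threshold_of_zero_mem_scalarMinimizers hq hq1 hlam hy0 hx hy) (hth h3)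
  · subst hy0
    exact absurd (eq_threshold_of_zero_mem_scalarMinimizers hq hq1 hlam hx0 hy hx) (hth h3)
  · exact eq_of_pos_mem_scalarMinimizers hq hq1 hlam hy0 hx0 hy hx

/-- Exchange argument: adding the two optimality inequalities cancels the penalties and leaves `(b -
a) * (y - x) ≥ 0`. -/
theorem scalarMinimizers_mono {q lam a b x y : ℝ} (hab : a ≤ b)
    (hx : scalarMinimizers q lam a = {x}) (hy : scalarMinimizers q lam b = {y}) : x ≤ y := by
  rcases hab.eq_or_lt with rfl | hab
  · rw [hx, Set.singleton_eq_singleton_iff] at hy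
    exact hy.le
  have hxm : x ∈ scalarMinimizers q lam a := hx ▸ rfl
  have hym : y ∈ scalarMinimizers q lam b := hy ▸ rfl
  have h1 := hxm.2 y hym.1
  have h2 := hym.2 x hxm.1
  simp only [scalarLoss] at h1 h2
  by_contra! h
  nlinarith [mul_pos (sub_pos.2 hab) (sub_pos.2 h)]

/-! ### Singular values and existence of singular bases. -/

theorem sum_fin_castLE {M : Type*} [AddCommMonoid M] {r k : ℕ} (h : r ≤ k) (f : Fin k → M)
    (hf : ∀ i : Fin k, r ≤ (i : ℕ) → f i = 0) : ∑ i, f i = ∑ i : Fin r, f (i.castLE h) := by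
  refine (Finset.sum_of_injOn (Fin.castLE h) (Fin.castLE_injective h).injOn (by simp)
    (fun i _ hi => hf i ?_) (fun _ _ => rfl)).symm
  by_contra! hlt
  exact hi ⟨⟨i, hlt⟩, by simp⟩

/-- The rectangular diagonal matrix of an infinite sequence. -/
noncomputable abbrev seqDiag (m n : ℕ) (s : ℕ → ℝ) : Matrix (Fin m) (Fin n) ℝ :=
  rectDiag fun i => s i

theorem seqDiag_apply {m n : ℕ} (s : ℕ → ℝ) (i : Fin m) (j : Fin n) :
    seqDiag m n s i j = if (i : ℕ) = j then s i else 0 := by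
  simp [seqDiag, rectDiag]

theorem seqDiag_transpose_mul_self {m n : ℕ} (s : ℕ → ℝ) (hs : ∀ i, min m n ≤ i → s i = 0) :
    (seqDiag m n s)ᵀ * seqDiag m n s = diagonal fun j : Fin n => s j ^ 2 := by
  ext j k
  simp only [mul_apply, transpose_apply, seqDiag_apply, diagonal_apply]
  by_cases hj : (j : ℕ) < m
  · rw [Finset.sum_eq_single ⟨j, hj⟩]
    · by_cases h : j = k <;> simp [h, Fin.val_inj, sq]
    · intro b _ hb
      have : (b : ℕ) ≠ j := fun h => hb (Fin.ext h)
      simp [this]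
    · simp
  · rw [Finset.sum_eq_zero, hs j (by omega)]
    · simp
    · intro b _
      have : (b : ℕ) ≠ j := by omega
      simp [this]

theorem antitone_fin_eq_of_map_univ_eq {n : ℕ} {f g : Fin n → ℝ} (hf : Antitone f)
    (hg : Antitone g) (h : Multiset.map f Finset.univ.val = Multiset.map g Finset.univ.val) :
    f = g := by
  rw [Fin.univ_val_map, Fin.univ_val_map, Multiset.coe_eq_coe] at h
  refine List.ofFn_injective (h.eq_of_pairwise (le := (· ≥ ·))
    (fun a b _ _ h1 h2 => le_antisymm h2 h1) ?_ ?_)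
  · exact List.pairwise_ofFn.2 fun i j hij => hf hij.le
  · exact List.pairwise_ofFn.2 fun i j hij => hg hij.le

theorem adjoint_comp_self_toEuclideanLin {m n : ℕ} (A : Matrix (Fin m) (Fin n) ℝ) :
    (toEuclideanLin A).adjoint ∘ₗ toEuclideanLin A = toEuclideanLin (Aᵀ * A) := by
  rw [← toEuclideanLin_conjTranspose_eq_adjoint, conjTranspose_eq_transpose_of_trivial,
    ← toLpLin_mul]

/-- The Gram matrix is orthogonally similar to `diag(s_j²)`; equal characteristic polynomials give
equal eigenvalue multisets, and both lists are sorted. -/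
theorem singularValues_mul_seqDiag_mul {m n : ℕ} {U : Matrix (Fin m) (Fin m) ℝ}
    {V : Matrix (Fin n) (Fin n) ℝ} (hU : U ∈ orthogonalGroup (Fin m) ℝ)
    (hV : V ∈ orthogonalGroup (Fin n) ℝ) {s : ℕ → ℝ} (hs : Antitone s) (hs0 : ∀ i, 0 ≤ s i)
    (hsr : ∀ i, min m n ≤ i → s i = 0) (i : ℕ) :
    (toEuclideanLin (U * seqDiag m n s * Vᵀ)).singularValues i = s i := by
  set T := toEuclideanLin (U * seqDiag m n s * Vᵀ) with hT
  have hn : Module.finrank ℝ (EuclideanSpace ℝ (Fin n)) = n := by simp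
  rcases le_or_gt n i with hi | hi
  · rw [T.singularValues_of_finrank_le (by rwa [hn]), hsr i ((min_le_right _ _).trans hi)]
  rw [mem_orthogonalGroup_iff'] at hU hV
  have hgram : (U * seqDiag m n s * Vᵀ)ᵀ * (U * seqDiag m n s * Vᵀ) =
      V * ((diagonal fun j : Fin n => s j ^ 2) * Vᵀ) := by
    rw [← seqDiag_transpose_mul_self s hsr]
    simp only [transpose_mul, transpose_transpose, Matrix.mul_assoc]
    rw [← Matrix.mul_assoc Uᵀ U, hU, Matrix.one_mul]
  have hchar : (T.adjoint ∘ₗ T).charpoly = (diagonal fun j : Fin n => s j ^ 2).charpoly := by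
    rw [hT, adjoint_comp_self_toEuclideanLin, hgram, toEuclideanLin, toLpLin_eq_toLin,
      charpoly_toLin, charpoly_mul_comm, Matrix.mul_assoc, hV, Matrix.mul_one]
  have hroots := T.isSymmetric_adjoint_comp_self.roots_charpoly_eq_eigenvalues hn
  rw [hchar, charpoly_diagonal, Polynomial.roots_prod _ _
    (Finset.prod_ne_zero_iff.2 fun _ _ => Polynomial.X_sub_C_ne_zero _)] at hroots
  simp only [Polynomial.roots_X_sub_C, Multiset.bind_singleton] at hroots
  have heq := antitone_fin_eq_of_map_univ_eq (fun a b hab => pow_le_pow_left₀ (hs0 _) (hs hab) 2)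
    (T.isSymmetric_adjoint_comp_self.eigenvalues_antitone hn) hroots
  rw [T.singularValues_of_lt hn hi, ← congrFun heq ⟨i, hi⟩, Real.sqrt_sq (hs0 _)]

theorem singularValues_toEuclideanLin_eq_zero {m n : ℕ} (A : Matrix (Fin m) (Fin n) ℝ) {i : ℕ}
    (hi : min m n ≤ i) : (toEuclideanLin A).singularValues i = 0 := by
  rcases min_le_iff.1 hi with h | h
  · rw [LinearMap.singularValues_eq_zero_iff_le_finrank_range]
    exact (Submodule.finrank_le _).trans (by simpa using h)
  · exact LinearMap.singularValues_of_finrank_le _ (by simpa using h)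

theorem of_orthonormalBasis_mem_orthogonalGroup {k : ℕ}
    (b : OrthonormalBasis (Fin k) ℝ (EuclideanSpace ℝ (Fin k))) :
    (Matrix.of fun i j => b j i) ∈ orthogonalGroup (Fin k) ℝ := by
  rw [mem_orthogonalGroup_iff']
  ext i j
  have := b.inner_eq_ite i j
  rw [PiLp.inner_apply] at this
  simp only [mul_apply, transpose_apply, of_apply, one_apply, ← this]
  exact Finset.sum_congr rfl fun l _ => by simp [mul_comm]

/-- The columns of `V` are an eigenbasis `b` of `AᵀA`; those of `U` are the normalized images `σ_i⁻¹
A b_i` where `σ_i ≠ 0`, completed to an orthonormal basis. -/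
theorem exists_isSVD {m n : ℕ} (A : Matrix (Fin m) (Fin n) ℝ) : ∃ U V, IsSVD A U V := by
  set T := toEuclideanLin A with hT
  have hn : Module.finrank ℝ (EuclideanSpace ℝ (Fin n)) = n := by simp
  set b := T.isSymmetric_adjoint_comp_self.eigenvectorBasis hn with hb
  have hinner : ∀ i j : Fin n, inner ℝ (T (b i)) (T (b j)) =
      if i = j then T.singularValues j ^ 2 else 0 := by
    intro i j
    have h1 := T.isSymmetric_adjoint_comp_self.apply_eigenvectorBasis hn j
    rw [← T.sq_singularValues_fin hn j] at h1
    rw [← LinearMap.adjoint_inner_right, ← LinearMap.comp_apply, h1, real_inner_smul_right,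
      b.inner_eq_ite]
    simp
  set u : Fin m → EuclideanSpace ℝ (Fin m) := fun i =>
    if h : (i : ℕ) < n then (T.singularValues i)⁻¹ • T (b ⟨i, h⟩) else 0 with hu
  have horth : Orthonormal ℝ (Set.domRestrict {i : Fin m | T.singularValues i ≠ 0} u) := by
    rw [orthonormal_iff_ite]
    rintro ⟨i, hi⟩ ⟨j, hj⟩
    have hlt : ∀ k : ℕ, T.singularValues k ≠ 0 → k < n := fun k hk => by
      by_contra! h
      exact hk (singularValues_toEuclideanLin_eq_zero A ((min_le_right _ _).trans h))
    have hi' := hlt _ hi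
    have hj' := hlt _ hj
    have hj0 : T.singularValues j ≠ 0 := hj
    simp only [Set.domRestrict_apply, hu, hi', hj', dite_true, real_inner_smul_left,
      real_inner_smul_right, hinner, Fin.mk.injEq, Subtype.mk.injEq, Fin.val_inj]
    split_ifs with h
    · subst h
      field_simp
    · simp
  obtain ⟨c, hc⟩ := horth.exists_orthonormalBasis_extension_of_card_eq (by simp)
  refine ⟨Matrix.of fun i j => c j i, Matrix.of fun i j => b j i,
    of_orthonormalBasis_mem_orthogonalGroup c, of_orthonormalBasis_mem_orthogonalGroup b, ?_⟩
  have hV := (mem_orthogonalGroup_iff _ _).1 (of_orthonormalBasis_mem_orthogonalGroup b)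
  suffices h : A * (Matrix.of fun i j => b j i) =
      (Matrix.of fun i j => c j i) * seqDiag m n T.singularValues by
    change A = _ * seqDiag m n T.singularValues * _
    rw [← h, Matrix.mul_assoc, hV, Matrix.mul_one]
  ext i j
  have hl : (A * (Matrix.of fun i j => b j i)) i j = T (b j) i := by
    simp [hT, toLpLin_apply, mul_apply, mulVec, dotProduct]
  rw [hl, mul_apply]
  simp only [of_apply, seqDiag_apply]
  by_cases hσ : T.singularValues j = 0
  · have : T (b j) = 0 := by
      rw [← inner_self_eq_zero (𝕜 := ℝ), hinner]
      simp [hσ]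
    rw [this, Finset.sum_eq_zero]
    · simp
    · intro k _
      split_ifs with h
      · rw [h, hσ, mul_zero]
      · simp
  · have hj : (j : ℕ) < m := by
      by_contra! h
      exact hσ (singularValues_toEuclideanLin_eq_zero A ((min_le_left _ _).trans h))
    rw [Finset.sum_eq_single ⟨j, hj⟩]
    · rw [hc ⟨j, hj⟩ hσ]
      simp [hu, hσ, mul_comm]
    · intro k _ hk
      have : (k : ℕ) ≠ j := fun h => hk (Fin.ext h)
      simp [this]
    · simp

/-! ### Frobenius distances in terms of singular bases. -/

theorem frobenius_norm_sq {m n : ℕ} (A : Matrix (Fin m) (Fin n) ℝ) :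
    ‖A‖ ^ 2 = ∑ i, ∑ j, A i j ^ 2 := by
  rw [frobenius_norm_def, ← Real.rpow_natCast, ← Real.rpow_mul (by positivity)]
  simp

theorem frobenius_norm_sq_orthogonal_mul {m n : ℕ} {U : Matrix (Fin m) (Fin m) ℝ}
    {V : Matrix (Fin n) (Fin n) ℝ} (hU : U ∈ orthogonalGroup (Fin m) ℝ)
    (hV : V ∈ orthogonalGroup (Fin n) ℝ) (A : Matrix (Fin m) (Fin n) ℝ) :
    ‖U * A * Vᵀ‖ ^ 2 = ‖A‖ ^ 2 := by
  have htr : ∀ B : Matrix (Fin m) (Fin n) ℝ, ‖B‖ ^ 2 = (B * Bᵀ).trace := by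
    intro B
    rw [frobenius_norm_sq]
    simp [trace, mul_apply, sq]
  rw [mem_orthogonalGroup_iff'] at hU hV
  have h : U * A * Vᵀ * (U * A * Vᵀ)ᵀ = U * (A * Aᵀ * Uᵀ) := by
    simp only [transpose_mul, transpose_transpose, Matrix.mul_assoc]
    rw [← Matrix.mul_assoc Vᵀ V, hV, Matrix.one_mul]
  rw [htr, htr, h, trace_mul_comm, Matrix.mul_assoc, hU, Matrix.mul_one]

theorem sum_seqDiag_mul {m n : ℕ} (s : ℕ → ℝ) (X : Matrix (Fin m) (Fin n) ℝ) :
    ∑ i, ∑ k, seqDiag m n s i k * X i k = ∑ l : Fin (min m n),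
      s l * X (l.castLE (min_le_left m n)) (l.castLE (min_le_right m n)) := by
  rw [sum_fin_castLE (min_le_left m n)]
  · refine Finset.sum_congr rfl fun l _ => ?_
    rw [Finset.sum_eq_single (l.castLE (min_le_right m n))]
    · simp [seqDiag_apply]
    · intro k _ hk
      have : (l : ℕ) ≠ k := fun h => hk (Fin.ext h.symm)
      simp [seqDiag_apply, this]
    · simp
  · intro i hi
    refine Finset.sum_eq_zero fun k _ => ?_
    have : (i : ℕ) ≠ k := by omega
    simp [seqDiag_apply, this]

theorem mul_seqDiag_mul_apply {m n : ℕ} (p : ℕ → ℝ) (W : Matrix (Fin m) (Fin m) ℝ)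
    (Z : Matrix (Fin n) (Fin n) ℝ) (i : Fin m) (k : Fin n) :
    (W * seqDiag m n p * Zᵀ) i k = ∑ l : Fin (min m n), p l *
      (W i (l.castLE (min_le_left m n)) * Z k (l.castLE (min_le_right m n))) := by
  refine Eq.trans ?_ (sum_seqDiag_mul p (Matrix.of fun a b => W i a * Z k b))
  rw [Finset.sum_comm]
  simp only [mul_apply, transpose_apply, of_apply, Finset.sum_mul]
  exact Finset.sum_congr rfl fun _ _ => Finset.sum_congr rfl fun _ _ => by ring

theorem frobenius_norm_sq_seqDiag {m n : ℕ} (s : ℕ → ℝ) :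
    ‖seqDiag m n s‖ ^ 2 = ∑ l : Fin (min m n), s l ^ 2 := by
  rw [frobenius_norm_sq]
  simp only [sq]
  rw [sum_seqDiag_mul]
  simp [seqDiag_apply]

theorem transpose_mul_mem_orthogonalGroup {k : ℕ} {U U' : Matrix (Fin k) (Fin k) ℝ}
    (hU : U ∈ orthogonalGroup (Fin k) ℝ) (hU' : U' ∈ orthogonalGroup (Fin k) ℝ) :
    Uᵀ * U' ∈ orthogonalGroup (Fin k) ℝ := by
  refine mul_mem ?_ hU'
  rw [mem_orthogonalGroup_iff, transpose_transpose]
  exact (mem_orthogonalGroup_iff' _ _).1 hU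

theorem frobenius_norm_sq_sub {m n : ℕ} {U U' : Matrix (Fin m) (Fin m) ℝ}
    {V V' : Matrix (Fin n) (Fin n) ℝ} (hU : U ∈ orthogonalGroup (Fin m) ℝ)
    (hU' : U' ∈ orthogonalGroup (Fin m) ℝ) (hV : V ∈ orthogonalGroup (Fin n) ℝ)
    (hV' : V' ∈ orthogonalGroup (Fin n) ℝ) (s p : ℕ → ℝ) :
    ‖U * seqDiag m n s * Vᵀ - U' * seqDiag m n p * V'ᵀ‖ ^ 2 =
      ∑ l : Fin (min m n), s l ^ 2 + ∑ l : Fin (min m n), p l ^ 2 -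
      2 * ∑ i : Fin (min m n), ∑ j : Fin (min m n), s i * p j *
        ((Uᵀ * U') (i.castLE (min_le_left m n)) (j.castLE (min_le_left m n)) *
         (Vᵀ * V') (i.castLE (min_le_right m n)) (j.castLE (min_le_right m n))) := by
  set X := Uᵀ * U' * seqDiag m n p * (Vᵀ * V')ᵀ with hX
  have hUU := (mem_orthogonalGroup_iff _ _).1 hU
  have hVV := (mem_orthogonalGroup_iff _ _).1 hV
  have hXn : ‖X‖ ^ 2 = ∑ l : Fin (min m n), p l ^ 2 := by
    rw [hX, frobenius_norm_sq_orthogonal_mul, frobenius_norm_sq_seqDiag]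
    · exact transpose_mul_mem_orthogonalGroup hU hU'
    · exact transpose_mul_mem_orthogonalGroup hV hV'
  have hfac : U * seqDiag m n s * Vᵀ - U' * seqDiag m n p * V'ᵀ =
      U * (seqDiag m n s - X) * Vᵀ := by
    have : U * X * Vᵀ = (U * Uᵀ) * (U' * seqDiag m n p * V'ᵀ) * (V * Vᵀ) := by
      simp only [hX, transpose_mul, transpose_transpose, Matrix.mul_assoc]
    rw [Matrix.mul_sub, Matrix.sub_mul, this, hUU, hVV, Matrix.one_mul, Matrix.mul_one]
  have hin : ∑ i, ∑ k, seqDiag m n s i k * X i k = ∑ i : Fin (min m n), ∑ j : Fin (min m n),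
      s i * p j * ((Uᵀ * U') (i.castLE (min_le_left m n)) (j.castLE (min_le_left m n)) *
         (Vᵀ * V') (i.castLE (min_le_right m n)) (j.castLE (min_le_right m n))) := by
    rw [sum_seqDiag_mul]
    refine Finset.sum_congr rfl fun i _ => ?_
    rw [hX, mul_seqDiag_mul_apply, Finset.mul_sum]
    exact Finset.sum_congr rfl fun j _ => by ring
  rw [hfac, frobenius_norm_sq_orthogonal_mul hU hV, ← hin, ← hXn, ← frobenius_norm_sq_seqDiag,
    frobenius_norm_sq, frobenius_norm_sq, frobenius_norm_sq, Finset.mul_sum,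
    ← Finset.sum_add_distrib, ← Finset.sum_sub_distrib]
  refine Finset.sum_congr rfl fun i _ => ?_
  rw [Finset.mul_sum, ← Finset.sum_add_distrib, ← Finset.sum_sub_distrib]
  exact Finset.sum_congr rfl fun k _ => by rw [Matrix.sub_apply]; ring

/-- Averaging a cost `a i + b j - 2 s i p j` that vanishes beyond index `r` against the squared
entries of an orthogonal matrix. -/
theorem sum_sq_mul_cost {k r : ℕ} (hr : r ≤ k) {W : Matrix (Fin k) (Fin k) ℝ}
    (hW : W ∈ orthogonalGroup (Fin k) ℝ) {a b s p : ℕ → ℝ} (ha : ∀ i, r ≤ i → a i = 0)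
    (hb : ∀ i, r ≤ i → b i = 0) (hs : ∀ i, r ≤ i → s i = 0) (hp : ∀ i, r ≤ i → p i = 0) :
    ∑ i : Fin k, ∑ j : Fin k, W i j ^ 2 * (a i + b j - 2 * (s i * p j)) =
      ∑ i : Fin r, a i + ∑ j : Fin r, b j -
      2 * ∑ i : Fin r, ∑ j : Fin r, s i * p j * W (i.castLE hr) (j.castLE hr) ^ 2 := by
  have hrow : ∀ i, ∑ j, W i j ^ 2 = 1 := fun i => by
    have := congrFun (congrFun ((mem_orthogonalGroup_iff _ _).1 hW) i) i
    simpa [mul_apply, sq] using this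
  have hcol : ∀ j, ∑ i, W i j ^ 2 = 1 := fun j => by
    have := congrFun (congrFun ((mem_orthogonalGroup_iff' _ _).1 hW) j) j
    simpa [mul_apply, sq] using this
  have h1 : ∑ i : Fin k, ∑ j : Fin k, W i j ^ 2 * a i = ∑ i : Fin r, a i := by
    simp only [← Finset.sum_mul, hrow, one_mul]
    exact sum_fin_castLE hr (fun i => a i) fun i hi => ha i hi
  have h2 : ∑ i : Fin k, ∑ j : Fin k, W i j ^ 2 * b j = ∑ j : Fin r, b j := by
    rw [Finset.sum_comm]
    simp only [← Finset.sum_mul, hcol, one_mul]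
    exact sum_fin_castLE hr (fun i => b i) fun i hi => hb i hi
  have h3 : ∑ i : Fin k, ∑ j : Fin k, s i * p j * W i j ^ 2 =
      ∑ i : Fin r, ∑ j : Fin r, s i * p j * W (i.castLE hr) (j.castLE hr) ^ 2 := by
    rw [sum_fin_castLE hr]
    · refine Finset.sum_congr rfl fun i _ => ?_
      rw [sum_fin_castLE hr]
      · rfl
      · intro j hj
        simp [hp j hj]
    · intro i hi
      simp [hs i hi]
  rw [← h1, ← h2, ← h3]
  simp only [Finset.mul_sum, ← Finset.sum_add_distrib, ← Finset.sum_sub_distrib]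
  exact Finset.sum_congr rfl fun _ _ => Finset.sum_congr rfl fun _ _ => by ring

/-! ### The excess identity and its equality case. -/

theorem loss_eq_sum {m n : ℕ} {L : ℕ} (hL : 1 ≤ L) (lam : ℝ) (T M : Matrix (Fin m) (Fin n) ℝ) :
    loss L lam T M = ‖T - M‖ ^ 2 + lam * ∑ i, sigma M i ^ (2 / (L : ℝ)) := by
  have hL' : (0 : ℝ) < L := by exact_mod_cast hL
  have h : 0 ≤ ∑ i, sigma M i ^ (2 / (L : ℝ)) :=
    Finset.sum_nonneg fun i _ => Real.rpow_nonneg (LinearMap.singularValues_nonneg _ _) _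
  rw [loss, schattenNorm, ← Real.rpow_mul h, one_div_mul_cancel (by positivity), Real.rpow_one]

/-- The excess of the regularized loss over the sum of scalar minima is a sum of three
nonnegative terms. -/
theorem loss_excess {m n : ℕ} {q lam : ℝ} (hq : 0 < q) {U U' : Matrix (Fin m) (Fin m) ℝ}
    {V V' : Matrix (Fin n) (Fin n) ℝ} (hU : U ∈ orthogonalGroup (Fin m) ℝ)
    (hU' : U' ∈ orthogonalGroup (Fin m) ℝ) (hV : V ∈ orthogonalGroup (Fin n) ℝ)
    (hV' : V' ∈ orthogonalGroup (Fin n) ℝ) {s p x : ℕ → ℝ} (hs : ∀ i, min m n ≤ i → s i = 0)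
    (hp : ∀ i, min m n ≤ i → p i = 0) (hx : ∀ i, min m n ≤ i → x i = 0) :
    ‖U * seqDiag m n s * Vᵀ - U' * seqDiag m n p * V'ᵀ‖ ^ 2 +
        lam * ∑ l : Fin (min m n), p l ^ q =
      ∑ i : Fin (min m n), scalarLoss q lam (s i) (x i) +
      (∑ i : Fin m, ∑ j : Fin m, (Uᵀ * U') i j ^ 2 *
        (scalarLoss q lam (s i) (p j) - scalarLoss q lam (s i) (x i))) / 2 +
      (∑ i : Fin n, ∑ j : Fin n, (Vᵀ * V') i j ^ 2 *
        (scalarLoss q lam (s i) (p j) - scalarLoss q lam (s i) (x i))) / 2 +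
      ∑ i : Fin (min m n), ∑ j : Fin (min m n), s i * p j *
        ((Uᵀ * U') (i.castLE (min_le_left m n)) (j.castLE (min_le_left m n)) -
         (Vᵀ * V') (i.castLE (min_le_right m n)) (j.castLE (min_le_right m n))) ^ 2 := by
  have hcost : ∀ i j : ℕ, scalarLoss q lam (s i) (p j) - scalarLoss q lam (s i) (x i) =
      (s i ^ 2 - scalarLoss q lam (s i) (x i)) + (p j ^ 2 + lam * p j ^ q) -
        2 * (s i * p j) := fun i j => by simp only [scalarLoss]; ring
  -- Since `0 ^ q = 0`, zero padding costs nothing, so the averages over `Fin m` and `Fin n` reduce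
  -- to the same `min m n` terms.
  have ha : ∀ i, min m n ≤ i → s i ^ 2 - scalarLoss q lam (s i) (x i) = 0 := fun i hi => by
    simp [scalarLoss, hx i hi, Real.zero_rpow hq.ne']
  have hb : ∀ i, min m n ≤ i → p i ^ 2 + lam * p i ^ q = 0 := fun i hi => by
    simp [hp i hi, Real.zero_rpow hq.ne']
  simp only [hcost]
  rw [frobenius_norm_sq_sub hU hU' hV hV',
    sum_sq_mul_cost (min_le_left m n) (transpose_mul_mem_orthogonalGroup hU hU')
      (a := fun i => s i ^ 2 - scalarLoss q lam (s i) (x i))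
      (b := fun j => p j ^ 2 + lam * p j ^ q) ha hb hs hp,
    sum_sq_mul_cost (min_le_right m n) (transpose_mul_mem_orthogonalGroup hV hV')
      (a := fun i => s i ^ 2 - scalarLoss q lam (s i) (x i))
      (b := fun j => p j ^ 2 + lam * p j ^ q) ha hb hs hp]
  have hsq : ∀ (f : Fin (min m n) → Fin (min m n) → ℝ) (w z : Fin (min m n) → Fin (min m n) → ℝ),
      ∑ i, ∑ j, f i j * (w i j - z i j) ^ 2 = ∑ i, ∑ j, f i j * w i j ^ 2 +
        ∑ i, ∑ j, f i j * z i j ^ 2 - 2 * ∑ i, ∑ j, f i j * (w i j * z i j) := fun f w z => by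
    simp only [Finset.mul_sum, ← Finset.sum_add_distrib, ← Finset.sum_sub_distrib]
    exact Finset.sum_congr rfl fun _ _ => Finset.sum_congr rfl fun _ _ => by ring
  rw [hsq (fun i j => s i * p j)
    (fun i j => (Uᵀ * U') (i.castLE (min_le_left m n)) (j.castLE (min_le_left m n)))
    (fun i j => (Vᵀ * V') (i.castLE (min_le_right m n)) (j.castLE (min_le_right m n)))]
  simp only [Finset.sum_add_distrib, Finset.sum_sub_distrib, ← Finset.mul_sum]
  ring

/-- The support condition on `W` replaces `p l` by `x i` throughout row `i`. If `x i ≠ 0`, row `i`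
of `W` can be replaced by row `i` of `Z`, and orthogonality of `Z` finishes. -/
theorem conj_seqDiag_eq_of_support {m n : ℕ} {W : Matrix (Fin m) (Fin m) ℝ}
    {Z : Matrix (Fin n) (Fin n) ℝ} (hZ : Z ∈ orthogonalGroup (Fin n) ℝ) {s p x : ℕ → ℝ}
    (hp : ∀ i, min m n ≤ i → p i = 0) (hx : ∀ i, min m n ≤ i → x i = 0)
    (hsx : ∀ i, s i = 0 → x i = 0)
    (hWp : ∀ i j : Fin m, W i j = 0 ∨ p j = x i) (hZp : ∀ i j : Fin n, Z i j = 0 ∨ p j = x i)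
    (hWZ : ∀ i j : Fin (min m n), s i * p j = 0 ∨
      W (i.castLE (min_le_left m n)) (j.castLE (min_le_left m n)) =
        Z (i.castLE (min_le_right m n)) (j.castLE (min_le_right m n))) :
    W * seqDiag m n p * Zᵀ = seqDiag m n x := by
  ext i k
  rw [mul_seqDiag_mul_apply, seqDiag_apply]
  have hpull : ∀ l : Fin (min m n), p l * (W i (l.castLE (min_le_left m n)) *
      Z k (l.castLE (min_le_right m n))) = x i * (W i (l.castLE (min_le_left m n)) *
      Z k (l.castLE (min_le_right m n))) := fun l => by
    rcases hWp i (l.castLE (min_le_left m n)) with h | h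
    · simp [h]
    · rw [← h]; rfl
  simp only [hpull, ← Finset.mul_sum]
  by_cases hxi : x i = 0
  · simp [hxi]
  have hi : (i : ℕ) < min m n := by
    by_contra! h
    exact hxi (hx i h)
  set i' : Fin n := ⟨i, hi.trans_le (min_le_right m n)⟩ with hi'
  have hsum : ∑ l : Fin (min m n), W i (l.castLE (min_le_left m n)) *
      Z k (l.castLE (min_le_right m n)) = ∑ l, Z i' l * Z k l := by
    rw [sum_fin_castLE (min_le_right m n)]
    · refine Finset.sum_congr rfl fun l _ => ?_
      congr 1
      -- When `s i * p l = 0`, `x i ≠ 0` forces `s i ≠ 0`, hence `p l = 0 ≠ x i`, and both entries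
      -- vanish.
      rcases hWZ ⟨i, hi⟩ l with h | h
      · have hpl : p l ≠ x i := by
          rcases mul_eq_zero.1 h with h | h
          · exact absurd (hsx i h) hxi
          · rw [h]; exact Ne.symm hxi
        rw [(hWp i (l.castLE (min_le_left m n))).resolve_right hpl,
          (hZp i' (l.castLE (min_le_right m n))).resolve_right hpl]
      · exact h
    · intro l hl
      rw [(hZp i' l).resolve_right (by rw [hp l hl]; exact Ne.symm hxi), zero_mul]
  have hone : ∑ l, Z i' l * Z k l = if i' = k then 1 else 0 := by
    have := congrFun (congrFun ((mem_orthogonalGroup_iff _ _).1 hZ) i') k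
    simpa [mul_apply, one_apply] using this
  rw [hsum, hone]
  have : i' = k ↔ (i : ℕ) = k := by rw [Fin.ext_iff]
  simp [this]

theorem minimizers_eq_singleton {m n L : ℕ} (hL : 1 ≤ L) {lam : ℝ}
    {T : Matrix (Fin m) (Fin n) ℝ} {U : Matrix (Fin m) (Fin m) ℝ} {V : Matrix (Fin n) (Fin n) ℝ}
    (hT : IsSVD T U V) {x : ℕ → ℝ} (hx : Antitone x) (hxr : ∀ i, min m n ≤ i → x i = 0)
    (hxs : ∀ i, (toEuclideanLin T).singularValues i = 0 → x i = 0)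
    (hmin : ∀ i, scalarMinimizers (2 / (L : ℝ)) lam ((toEuclideanLin T).singularValues i) =
      {x i}) :
    minimizers L lam T = {U * seqDiag m n x * Vᵀ} := by
  have hL' : (0 : ℝ) < L := by exact_mod_cast hL
  have hq : 0 < 2 / (L : ℝ) := by positivity
  set q := 2 / (L : ℝ) with hqdef
  set s : ℕ → ℝ := fun i => (toEuclideanLin T).singularValues i with hsdef
  have hs0 : ∀ i, 0 ≤ s i := fun i => LinearMap.singularValues_nonneg _ i
  have hsr : ∀ i, min m n ≤ i → s i = 0 := fun i hi => singularValues_toEuclideanLin_eq_zero T hi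
  have hxm : ∀ i, x i ∈ scalarMinimizers q lam (s i) := fun i => by rw [hmin i]; rfl
  have hx0 : ∀ i, 0 ≤ x i := fun i => (hxm i).1
  obtain ⟨hU, hV, hTeq⟩ := hT
  change T = U * seqDiag m n s * Vᵀ at hTeq
  have hvalue : loss L lam T (U * seqDiag m n x * Vᵀ) =
      ∑ i : Fin (min m n), scalarLoss q lam (s i) (x i) := by
    have hsig : ∀ i, sigma (U * seqDiag m n x * Vᵀ) i = x i := fun i =>
      singularValues_mul_seqDiag_mul hU hV hx hx0 hxr i
    have hsub : U * seqDiag m n s * Vᵀ - U * seqDiag m n x * Vᵀ =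
        U * seqDiag m n (s - x) * Vᵀ := by
      have : seqDiag m n (s - x) = seqDiag m n s - seqDiag m n x := by
        ext i j
        rw [Matrix.sub_apply, seqDiag_apply, seqDiag_apply, seqDiag_apply]
        split_ifs <;> simp
      rw [this, Matrix.mul_sub, Matrix.sub_mul]
    rw [loss_eq_sum hL, hTeq, hsub, frobenius_norm_sq_orthogonal_mul hU hV,
      frobenius_norm_sq_seqDiag]
    simp only [hsig, Finset.mul_sum, ← Finset.sum_add_distrib]
    rfl
  have hlower : ∀ N : Matrix (Fin m) (Fin n) ℝ,
      ∑ i : Fin (min m n), scalarLoss q lam (s i) (x i) ≤ loss L lam T N ∧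
      (loss L lam T N ≤ ∑ i : Fin (min m n), scalarLoss q lam (s i) (x i) →
        N = U * seqDiag m n x * Vᵀ) := by
    intro N
    obtain ⟨U', V', hU', hV', hN⟩ := exists_isSVD N
    set p : ℕ → ℝ := fun i => (toEuclideanLin N).singularValues i with hpdef
    change N = U' * seqDiag m n p * V'ᵀ at hN
    have hp0 : ∀ i, 0 ≤ p i := fun i => LinearMap.singularValues_nonneg _ i
    have hpr : ∀ i, min m n ≤ i → p i = 0 :=
      fun i hi => singularValues_toEuclideanLin_eq_zero N hi
    have hex := loss_excess (lam := lam) hq hU hU' hV hV' hsr hpr hxr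
    rw [← hTeq, ← hN] at hex
    have hloss : loss L lam T N = ‖T - N‖ ^ 2 + lam * ∑ l : Fin (min m n), p l ^ q :=
      loss_eq_sum hL lam T N
    rw [← hloss] at hex
    set W := Uᵀ * U' with hWdef
    set Z := Vᵀ * V' with hZdef
    have hgap : ∀ i j : ℕ, 0 ≤ scalarLoss q lam (s i) (p j) - scalarLoss q lam (s i) (x i) :=
      fun i j => sub_nonneg.2 ((hxm i).2 _ (hp0 j))
    have hterm : ∀ {k : ℕ} (Q : Matrix (Fin k) (Fin k) ℝ) (i j : Fin k), 0 ≤ Q i j ^ 2 *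
        (scalarLoss q lam (s i) (p j) - scalarLoss q lam (s i) (x i)) :=
      fun Q i j => mul_nonneg (sq_nonneg _) (hgap i j)
    have hE : ∀ {k : ℕ} (Q : Matrix (Fin k) (Fin k) ℝ), 0 ≤ ∑ i : Fin k, ∑ j : Fin k, Q i j ^ 2 *
        (scalarLoss q lam (s i) (p j) - scalarLoss q lam (s i) (x i)) :=
      fun Q => Finset.sum_nonneg fun i _ => Finset.sum_nonneg fun j _ => hterm Q i j
    have hEzero : ∀ {k : ℕ} (Q : Matrix (Fin k) (Fin k) ℝ), ∑ i : Fin k, ∑ j : Fin k, Q i j ^ 2 *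
        (scalarLoss q lam (s i) (p j) - scalarLoss q lam (s i) (x i)) = 0 →
        ∀ i j : Fin k, Q i j = 0 ∨ p j = x i := by
      intro k Q hQ i j
      rw [Finset.sum_eq_zero_iff_of_nonneg
        fun i _ => Finset.sum_nonneg fun j _ => hterm Q i j] at hQ
      have h1 := hQ i (Finset.mem_univ _)
      rw [Finset.sum_eq_zero_iff_of_nonneg fun j _ => hterm Q i j] at h1
      rcases mul_eq_zero.1 (h1 j (Finset.mem_univ _)) with h | h
      · exact Or.inl (pow_eq_zero_iff two_ne_zero |>.1 h)
      · right
        -- A zero gap makes `p j` another minimizer for the target `s i`, so scalar uniqueness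
        -- identifies it with `x i`.
        have : p j ∈ scalarMinimizers q lam (s i) :=
          ⟨hp0 j, fun y hy => (sub_eq_zero.1 h).le.trans ((hxm i).2 y hy)⟩
        rwa [hmin i] at this
    have hRterm : ∀ i j : Fin (min m n), 0 ≤ s i * p j *
        (W (i.castLE (min_le_left m n)) (j.castLE (min_le_left m n)) -
         Z (i.castLE (min_le_right m n)) (j.castLE (min_le_right m n))) ^ 2 :=
      fun i j => mul_nonneg (mul_nonneg (hs0 i) (hp0 j)) (sq_nonneg _)
    have hR := Finset.sum_nonneg fun i (_ : i ∈ Finset.univ) =>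
      Finset.sum_nonneg fun j (_ : j ∈ Finset.univ) => hRterm i j
    have hEW := hE W
    have hEZ := hE Z
    refine ⟨by linarith, fun hle => ?_⟩
    have hWp := hEzero W (by linarith)
    have hZp := hEzero Z (by linarith)
    have hR0 := le_antisymm (by linarith) hR
    rw [Finset.sum_eq_zero_iff_of_nonneg
      fun i _ => Finset.sum_nonneg fun j _ => hRterm i j] at hR0
    have hWZ : ∀ i j : Fin (min m n), s i * p j = 0 ∨
        W (i.castLE (min_le_left m n)) (j.castLE (min_le_left m n)) =
          Z (i.castLE (min_le_right m n)) (j.castLE (min_le_right m n)) := by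
      intro i j
      have h1 := hR0 i (Finset.mem_univ _)
      rw [Finset.sum_eq_zero_iff_of_nonneg fun j _ => hRterm i j] at h1
      exact (mul_eq_zero.1 (h1 j (Finset.mem_univ _))).imp_right
        fun h => sub_eq_zero.1 (pow_eq_zero_iff two_ne_zero |>.1 h)
    have hconj := conj_seqDiag_eq_of_support (transpose_mul_mem_orthogonalGroup hV hV') hpr hxr
      hxs hWp hZp hWZ
    have hUU := (mem_orthogonalGroup_iff _ _).1 hU
    have hVV := (mem_orthogonalGroup_iff _ _).1 hV
    have : U * (W * seqDiag m n p * (Vᵀ * V')ᵀ) * Vᵀ =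
        (U * Uᵀ) * (U' * seqDiag m n p * V'ᵀ) * (V * Vᵀ) := by
      simp only [hWdef, transpose_mul, transpose_transpose, Matrix.mul_assoc]
    rw [hN, ← hconj, this, hUU, hVV, Matrix.one_mul, Matrix.mul_one]
  refine Set.eq_singleton_iff_unique_mem.2 ⟨fun N => ?_, fun N hN => ?_⟩
  · rw [hvalue]
    exact (hlower N).1
  · exact (hlower N).2 (hvalue ▸ hN (U * seqDiag m n x * Vᵀ))

end SchattenReg

theorem mainTheorem1 {m n : ℕ} (L : ℕ) (hL : 1 ≤ L) (lam : ℝ) (hlam : 0 < lam)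
    (T : Matrix (Fin m) (Fin n) ℝ)
    (hT : 3 ≤ L → ∀ i : Fin (min m n),
      SchattenReg.sigma T i ≠ SchattenReg.threshold (2 / (L : ℝ)) lam) :
    ∃ M : Matrix (Fin m) (Fin n) ℝ,
      SchattenReg.minimizers L lam T = {M} ∧
      (∃ U V, SchattenReg.IsSVD T U V) ∧
      (∀ U V, SchattenReg.IsSVD T U V → SchattenReg.IsSVD M U V) ∧
      (∀ i : Fin (min m n),
        SchattenReg.scalarMinimizers (2 / (L : ℝ)) lam (SchattenReg.sigma T i) =
          {SchattenReg.sigma M i}) := by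
  have hL' : (0 : ℝ) < L := by exact_mod_cast hL
  have hq : 0 < 2 / (L : ℝ) := by positivity
  have hzero := SchattenReg.scalarMinimizers_target_zero hq hlam
  have hex : ∀ i : ℕ, ∃ x, SchattenReg.scalarMinimizers (2 / (L : ℝ)) lam
      ((Matrix.toEuclideanLin T).singularValues i) = {x} := by
    intro i
    rcases lt_or_ge i (min m n) with hi | hi
    · exact SchattenReg.scalarMinimizers_eq_singleton hL hlam
        (LinearMap.singularValues_nonneg _ _) fun h3 => hT h3 ⟨i, hi⟩
    -- Padding indices have target `0`, whose minimizer is `0` without any threshold condition.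
    · rw [SchattenReg.singularValues_toEuclideanLin_eq_zero T hi]
      exact ⟨0, hzero⟩
  choose x hmin using hex
  have hxs : ∀ i, (Matrix.toEuclideanLin T).singularValues i = 0 → x i = 0 := by
    intro i hi
    have h := hmin i
    rw [hi, hzero, Set.singleton_eq_singleton_iff] at h
    exact h.symm
  have hxr : ∀ i, min m n ≤ i → x i = 0 :=
    fun i hi => hxs i (SchattenReg.singularValues_toEuclideanLin_eq_zero T hi)
  have hx : Antitone x := fun i j hij =>
    SchattenReg.scalarMinimizers_mono (LinearMap.singularValues_antitone _ hij) (hmin j) (hmin i)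
  have hx0 : ∀ i, 0 ≤ x i := fun i => (show x i ∈ SchattenReg.scalarMinimizers _ _ _ by
    rw [hmin i]; rfl).1
  obtain ⟨U, V, hUV⟩ := SchattenReg.exists_isSVD T
  have huniq := SchattenReg.minimizers_eq_singleton hL hUV hx hxr hxs hmin
  have hsig : SchattenReg.sigma (U * SchattenReg.seqDiag m n x * Vᵀ) =
      fun i : Fin (min m n) => x i :=
    funext fun i => SchattenReg.singularValues_mul_seqDiag_mul hUV.1 hUV.2.1 hx hx0 hxr i
  refine ⟨_, huniq, ⟨U, V, hUV⟩, fun U₁ V₁ h₁ => ⟨h₁.1, h₁.2.1, ?_⟩, fun i => ?_⟩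
  · rw [hsig]
    -- The set of minimizers does not depend on the chosen bases, so computing it with `U₁`, `V₁`
    -- gives the same matrix.
    exact Set.singleton_injective
      (huniq.symm.trans (SchattenReg.minimizers_eq_singleton hL h₁ hx hxr hxs hmin))
  · rw [hsig]
    exact hmin i
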